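/- Let $\mathfrak{A}$ be a (not necessarily unital) $C^*$-algebra, let $\omega$ be a state on $\mathfrak{A}$ (a positive linear functional of norm one), and let $t\mapsto\alpha_t$, $t\in\mathbb{R}$, be a strongly continuous one-parameter group of $*$-automorphisms of $\mathfrak{A}$, i.e. $\alpha_{s+t}=\alpha_s\circ\alpha_t$ and $t\mapsto\alpha_t(A)$ is norm continuous for each $A\in\mathfrak{A}$. Let $\delta$ be its generator: $D(\delta)$ is the set of all $A\in\mathfrak{A}$ for which the norm limit $\delta(A)=\lim_{t\to0}\frac{\alpha_t(A)-A}{t}$ exists. Call $\omega$ a ground state for $\alpha$ if $\omega\circ\alpha_t=\omega$ for all $t\in\mathbb{R}$ and the following operator $H_\omega$ is positive. Let $(\pi_\omega,\mathcal{H}_\omega,\Omega)$ be the GNS representation of $\omega$, with inner product linear in the second variable, and let $U(t)$ be the strongly continuous one-parameter group of unitaries on $\mathcal{H}_\omega$ determined by $U(t)\pi_\omega(A)\Omega=\pi_\omega(\alpha_t(A))\Omega$ for $A\in\mathfrak{A}$. Then $H_\omega$ is the self-adjoint operator with $U(t)=e^{itH_\omega}$, i.e. $H_\omega\psi=-i\left.\frac{d}{dt}\right|_{t=0}U(t)\psi$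 with domain all $\psi\in\mathcal{H}_\omega$ for which this derivative exists. Positivity means $\langle\psi,H_\omega\psi\rangle\geq0$ for all $\psi$ in the domain of $H_\omega$. Then the following are equivalent: 1. $\omega$ is a ground state for $\alpha$; 2. $-i\,\omega(A^*\delta(A))\geq0$ (that is, it is real and nonnegative) for all $A\in D(\delta)$. -/

import Mathlib

open scoped ComplexOrder InnerProductSpace

noncomputable section

/-- The infinitesimal generator at `0` of a one-parameter family `T` of linear operators:
its domain consists of all `x` for which `t ↦ T t x` has a (norm) derivative at `t = 0`, and its
value at such an `x` is that derivative. When `T 0 = 1`, this is the limit of `(T t x - x) / t`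
as `t → 0`. -/
def infinitesimalGenerator {E : Type*} [NormedAddCommGroup E] [NormedSpace ℂ E]
    (T : ℝ → E →ₗ[ℂ] E) : E →ₗ.[ℂ] E where
  domain :=
    { carrier := {x | DifferentiableAt ℝ (fun t : ℝ => T t x) 0}
      zero_mem' := by simp
      add_mem' := fun {x y} hx hy => by
        simpa using DifferentiableAt.fun_add (𝕜 := ℝ) hx hy
      smul_mem' := fun c x hx => by
        simpa using DifferentiableAt.fun_const_smul (𝕜 := ℝ) (R := ℂ) hx c }
  toFun :=
    { toFun := fun x => deriv (fun t : ℝ => T t (x : E)) 0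
      map_add' := fun x y => by
        simpa using deriv_fun_add (𝕜 := ℝ) x.2 y.2
      map_smul' := fun c x => by
        simpa using deriv_fun_const_smul (𝕜 := ℝ) (R := ℂ) c x.2 }

/-- A strongly continuous one-parameter group `t ↦ α t` of `*`-automorphisms of the C*-algebra `A`;
the pair of `A` and such a group is a C*-dynamical system. -/
structure CStarDynamics (A : Type*) [NonUnitalCStarAlgebra A] where
  /-- The automorphism at time `t`. -/
  aut : ℝ → A ≃⋆ₐ[ℂ] A
  /-- The group law. -/
  aut_add : ∀ s t a, aut (s + t) a = aut s (aut t a)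
  /-- Strong continuity. -/
  continuous_aut : ∀ a, Continuous fun t => aut t a

/-- A strongly continuous one-parameter group `t ↦ U t` of unitaries on the Hilbert space `H`. -/
structure UnitaryGroup (H : Type*) [NormedAddCommGroup H] [InnerProductSpace ℂ H] where
  /-- The unitary at time `t`. -/
  uni : ℝ → H ≃ₗᵢ[ℂ] H
  /-- The group law. -/
  uni_add : ∀ s t ψ, uni (s + t) ψ = uni s (uni t ψ)
  /-- Strong continuity. -/
  continuous_uni : ∀ ψ, Continuous fun t => uni t ψ

/-- The Hamiltonian of a strongly continuous unitary group, that is, the operator `H` of Stone's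
theorem with `U t = exp (i t H)`: its domain consists of the `ψ` for which `t ↦ U t ψ` is
differentiable at `0`, and there `H ψ = -i d/dt (U t ψ)` at `t = 0`. -/
def UnitaryGroup.hamiltonian {H : Type*} [NormedAddCommGroup H] [InnerProductSpace ℂ H]
    (U : UnitaryGroup H) : H →ₗ.[ℂ] H :=
  (-Complex.I) • infinitesimalGenerator fun t => (U.uni t).toLinearEquiv.toLinearMap

/-- An operator `T` is positive if `⟪ψ, T ψ⟫` is real and nonnegative for all `ψ` in its domain. -/
def LinearPMap.IsPositiveOp {H : Type*} [NormedAddCommGroup H] [InnerProductSpace ℂ H]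
    (T : H →ₗ.[ℂ] H) : Prop :=
  ∀ ψ : T.domain, 0 ≤ ⟪(ψ : H), T ψ⟫_ℂ

namespace CStarDynamics

/-- The automorphism at time `t` as a linear map. -/
def lin {A : Type*} [NonUnitalCStarAlgebra A] (α : CStarDynamics A) (t : ℝ) : A →ₗ[ℂ] A where
  toFun := α.aut t
  map_add' := map_add (α.aut t)
  map_smul' := map_smul (α.aut t)

/-- The generator `δ` of the dynamics: `δ a` is the norm limit of `(α t a - a) / t` as `t → 0`,
with domain all `a` for which this limit exists. -/
def generator {A : Type*} [NonUnitalCStarAlgebra A] (α : CStarDynamics A) : A →ₗ.[ℂ] A :=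
  infinitesimalGenerator α.lin

theorem aut_zero {A : Type*} [NonUnitalCStarAlgebra A] (α : CStarDynamics A) (a : A) :
    α.aut 0 a = a :=
  (α.aut 0).injective (by
    change α.aut 0 (α.aut 0 a) = α.aut 0 a
    rw [← α.aut_add, add_zero])

/-- `a` lies in the domain of `δ` with `δ a = b` exactly if `(α t a - a) / t → b` as `t → 0`. -/
theorem mem_graph_generator_iff {A : Type*} [NonUnitalCStarAlgebra A] (α : CStarDynamics A)
    (a b : A) : (a, b) ∈ α.generator.graph ↔
      Filter.Tendsto (fun t : ℝ => t⁻¹ • (α.aut t a - a)) (nhdsWithin 0 {0}ᶜ) (nhds b) := by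
  have key : HasDerivAt (fun t : ℝ => α.aut t a) b 0 ↔
      Filter.Tendsto (fun t : ℝ => t⁻¹ • (α.aut t a - a)) (nhdsWithin 0 {0}ᶜ) (nhds b) := by
    rw [hasDerivAt_iff_tendsto_slope_zero]
    simp [α.aut_zero]
  rw [← key, LinearPMap.mem_graph_iff]
  constructor
  · rintro ⟨x, hx, rfl⟩
    obtain rfl : (x : A) = a := hx
    exact DifferentiableAt.hasDerivAt (𝕜 := ℝ) x.2
  · intro h
    exact ⟨⟨a, h.differentiableAt⟩, rfl, h.deriv⟩

section GNS

variable {A : Type*} [NonUnitalCStarAlgebra A] [PartialOrder A] [StarOrderedRing A]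

/-- The functional `ω` is invariant under the dynamics. -/
def Invariant (α : CStarDynamics A) (ω : A →ₚ[ℂ] ℂ) : Prop :=
  ∀ t a, ω (α.aut t a) = ω a

/-- The isometry `[a] ↦ [α t a]` of the pre-Hilbert space `A` with form `⟪[a], [b]⟫ = ω (a* b)`. -/
def preGNSIsometry (α : CStarDynamics A) (ω : A →ₚ[ℂ] ℂ) (h : α.Invariant ω) (t : ℝ) :
    ω.PreGNS →ₗᵢ[ℂ] ω.PreGNS where
  toLinearMap := ω.toPreGNS.toLinearMap ∘ₗ α.lin t ∘ₗ ω.ofPreGNS.toLinearMap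
  norm_map' := fun x => by
    rw [PositiveLinearMap.preGNS_norm_def, PositiveLinearMap.preGNS_norm_def]
    congr 2
    rw [← h t (star (ω.ofPreGNS x) * ω.ofPreGNS x), map_mul (α.aut t), map_star (α.aut t)]
    rfl

/-- The extension of `[a] ↦ [α t a]` to the GNS Hilbert space. -/
def gnsMap (α : CStarDynamics A) (ω : A →ₚ[ℂ] ℂ) (h : α.Invariant ω) (t : ℝ) :
    ω.GNS →L[ℂ] ω.GNS :=
  (α.preGNSIsometry ω h t).toContinuousLinearMap.completion

theorem gnsMap_coe (α : CStarDynamics A) (ω : A →ₚ[ℂ] ℂ) (h : α.Invariant ω) (t : ℝ) (a : A) :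
    α.gnsMap ω h t (ω.toPreGNS a : ω.PreGNS) = (ω.toPreGNS (α.aut t a) : ω.PreGNS) := by
  simp [gnsMap, preGNSIsometry, lin]

theorem gnsMap_add (α : CStarDynamics A) (ω : A →ₚ[ℂ] ℂ) (h : α.Invariant ω) (s t : ℝ)
    (ψ : ω.GNS) : α.gnsMap ω h (s + t) ψ = α.gnsMap ω h s (α.gnsMap ω h t ψ) := by
  induction ψ using UniformSpace.Completion.induction_on with
  | hp => apply isClosed_eq <;> fun_prop
  | ih x =>
    obtain ⟨a, rfl⟩ := ω.toPreGNS.surjective x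
    simp only [gnsMap_coe, α.aut_add]

theorem gnsMap_zero (α : CStarDynamics A) (ω : A →ₚ[ℂ] ℂ) (h : α.Invariant ω)
    (ψ : ω.GNS) : α.gnsMap ω h 0 ψ = ψ := by
  induction ψ using UniformSpace.Completion.induction_on with
  | hp => apply isClosed_eq <;> fun_prop
  | ih x =>
    obtain ⟨a, rfl⟩ := ω.toPreGNS.surjective x
    simp only [gnsMap_coe, α.aut_zero]

theorem norm_gnsMap (α : CStarDynamics A) (ω : A →ₚ[ℂ] ℂ) (h : α.Invariant ω) (t : ℝ)
    (ψ : ω.GNS) : ‖α.gnsMap ω h t ψ‖ = ‖ψ‖ := by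
  induction ψ using UniformSpace.Completion.induction_on with
  | hp => apply isClosed_eq <;> fun_prop
  | ih x => simp [gnsMap]

theorem continuous_toGNS (ω : A →ₚ[ℂ] ℂ) :
    Continuous fun a : A => ((ω.toPreGNS a : ω.PreGNS) : ω.GNS) := by
  obtain ⟨C, hC⟩ := ω.exists_norm_apply_le
  have hb : ∀ a : A, ‖ω.toPreGNS a‖ ≤ Real.sqrt C * ‖a‖ := fun a => by
    rw [PositiveLinearMap.preGNS_norm_def, PositiveLinearMap.ofPreGNS_toPreGNS]
    refine Real.sqrt_le_iff.2 ⟨by positivity, ?_⟩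
    calc (ω (star a * a)).re ≤ ‖ω (star a * a)‖ := Complex.re_le_norm _
      _ ≤ C * ‖star a * a‖ := hC _
      _ = (Real.sqrt C * ‖a‖) ^ 2 := by
        rw [CStarRing.norm_star_mul_self, mul_pow, Real.sq_sqrt C.coe_nonneg, sq]
  exact (UniformSpace.Completion.continuous_coe _).comp
    (ω.toPreGNS.toLinearMap.mkContinuous _ hb).continuous

theorem continuous_gnsMap (α : CStarDynamics A) (ω : A →ₚ[ℂ] ℂ) (h : α.Invariant ω)
    (ψ : ω.GNS) : Continuous fun t => α.gnsMap ω h t ψ := by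
  induction ψ using UniformSpace.Completion.induction_on with
  | hp =>
    refine isClosed_of_closure_subset fun ψ hψ => ?_
    refine Metric.continuous_iff.2 fun s ε hε => ?_
    obtain ⟨φ, hφ, hd⟩ := Metric.mem_closure_iff.1 hψ (ε / 3) (by positivity)
    obtain ⟨r, hr, hr'⟩ := Metric.continuous_iff.1 hφ s (ε / 3) (by positivity)
    refine ⟨r, hr, fun t ht => ?_⟩
    have e : ∀ u, dist (α.gnsMap ω h u ψ) (α.gnsMap ω h u φ) = dist ψ φ := fun u => by
      rw [dist_eq_norm, dist_eq_norm, ← map_sub, norm_gnsMap]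
    calc dist (α.gnsMap ω h t ψ) (α.gnsMap ω h s ψ)
        ≤ dist (α.gnsMap ω h t ψ) (α.gnsMap ω h t φ)
          + dist (α.gnsMap ω h t φ) (α.gnsMap ω h s φ)
          + dist (α.gnsMap ω h s φ) (α.gnsMap ω h s ψ) := dist_triangle4 _ _ _ _
      _ < ε := by
        rw [e t, dist_comm _ (α.gnsMap ω h s ψ), e s]
        linarith [hr' t ht]
  | ih x =>
    obtain ⟨a, rfl⟩ := ω.toPreGNS.surjective x
    simp only [gnsMap_coe]
    exact (continuous_toGNS ω).comp (α.continuous_aut a)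

/-- For an invariant `ω`, the strongly continuous unitary group on the GNS Hilbert space determined
by `U t [a] = [α t a]`, where `[a]` is the class of `a` (which is `π a Ω` for the GNS representation
`π` with cyclic vector `Ω`). In other words, `U t (π a) (U t)* = π (α t a)` and `U t Ω = Ω`. -/
def gnsUnitaryGroup (α : CStarDynamics A) (ω : A →ₚ[ℂ] ℂ) (h : α.Invariant ω) :
    UnitaryGroup ω.GNS where
  uni := fun t =>
    { toLinearEquiv := LinearEquiv.ofLinearMap (α.gnsMap ω h t).toLinearMap
        (α.gnsMap ω h (-t)).toLinearMap
        (LinearMap.ext fun ψ => by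
          simpa [gnsMap_zero] using (α.gnsMap_add ω h t (-t) ψ).symm)
        (LinearMap.ext fun ψ => by
          simpa [gnsMap_zero] using (α.gnsMap_add ω h (-t) t ψ).symm)
      norm_map' := fun ψ => α.norm_gnsMap ω h t ψ }
  uni_add := α.gnsMap_add ω h
  continuous_uni := α.continuous_gnsMap ω h

/-- The group `U` acts on the classes `[a]` by the dynamics. -/
theorem gnsUnitaryGroup_coe (α : CStarDynamics A) (ω : A →ₚ[ℂ] ℂ) (h : α.Invariant ω) (t : ℝ)
    (a : A) : (α.gnsUnitaryGroup ω h).uni t (ω.toPreGNS a : ω.PreGNS) =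
      (ω.toPreGNS (α.aut t a) : ω.PreGNS) :=
  α.gnsMap_coe ω h t a

/-- The group `U` implements the dynamics in the GNS representation `π`. -/
theorem gnsUnitaryGroup_implements (α : CStarDynamics A) (ω : A →ₚ[ℂ] ℂ) (h : α.Invariant ω)
    (t : ℝ) (a : A) (ψ : ω.GNS) :
    (α.gnsUnitaryGroup ω h).uni t
      (ω.gnsNonUnitalStarAlgHom a (((α.gnsUnitaryGroup ω h).uni t).symm ψ)) =
      ω.gnsNonUnitalStarAlgHom (α.aut t a) ψ := by
  obtain ⟨φ, rfl⟩ := ((α.gnsUnitaryGroup ω h).uni t).surjective ψ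
  rw [LinearIsometryEquiv.symm_apply_apply]
  change α.gnsMap ω h t (ω.gnsNonUnitalStarAlgHom a φ) =
    ω.gnsNonUnitalStarAlgHom (α.aut t a) (α.gnsMap ω h t φ)
  induction φ using UniformSpace.Completion.induction_on with
  | hp => apply isClosed_eq <;> fun_prop
  | ih x =>
    obtain ⟨b, rfl⟩ := ω.toPreGNS.surjective x
    simp [gnsMap_coe]

/-- A state on a C*-algebra: a positive linear functional of norm one. -/
def _root_.PositiveLinearMap.IsState (ω : A →ₚ[ℂ] ℂ) : Prop :=
  ‖(⟨ω.toLinearMap, map_continuous ω⟩ : A →L[ℂ] ℂ)‖ = 1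

/-- `ω` is a ground state for `α`: it is invariant, and the Hamiltonian `H_ω` implementing the
dynamics in its GNS representation is positive. -/
def IsGroundState (α : CStarDynamics A) (ω : A →ₚ[ℂ] ℂ) : Prop :=
  ω.IsState ∧ ∃ h : α.Invariant ω, (α.gnsUnitaryGroup ω h).hamiltonian.IsPositiveOp

end GNS

end CStarDynamics

end

/-! Write `[a]` for the GNS class of `a`. If `ω` is invariant, `[·]` is bounded and intertwines `α`
with `U`, so for `a ∈ D(δ)` one has `H_ω [a] = -i [δ a]` and `-i ω(a* δ a) = ⟪[a], H_ω [a]⟫`. This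
gives 1 ⇒ 2.

For the converse, reality of `-i ω(a* δ a)` makes `ω(α_t(a* a))` constant in `t` for `a ∈ D(δ)`;
density of `D(δ)` and the fact that positive elements span give invariance. Positivity is known at
first only on the classes of `D(δ)`. Instead of showing that these form a core for `H_ω`, test the
condition on `∫₀ʳ α_s a ds`, which is in `D(δ)` for every `a` and is sent by `δ` to `α_r a - a`. The
resulting inequality `0 ≤ -i ⟪∫₀ʳ U_s ψ ds, U_r ψ - ψ⟫` involves only bounded operators, so it
passes from classes to all `ψ`. Dividing by `r²` and letting `r → 0` gives `⟪ψ, H_ω ψ⟫ ≥ 0` on the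
whole domain. -/

namespace CStarDynamics

open MeasureTheory Filter Topology

/-! ### Orbit integrals and the domain of the generator -/

section Dynamics

variable {A : Type*} [NonUnitalCStarAlgebra A]

/-- The automorphism at time `t` as a continuous linear map. -/
def autCLM (α : CStarDynamics A) (t : ℝ) : A →L[ℂ] A :=
  ⟨α.lin t, (NonUnitalStarAlgHom.isometry (α.aut t) (α.aut t).injective).continuous⟩

theorem autCLM_apply (α : CStarDynamics A) (t : ℝ) (a : A) : α.autCLM t a = α.aut t a := rfl

/-- The integral of the orbit of `a` over `[0, h]`. -/
noncomputable def orbitIntegral (α : CStarDynamics A) (h : ℝ) (a : A) : A := ∫ s in (0 : ℝ)..h, α.aut s a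

theorem aut_orbitIntegral (α : CStarDynamics A) (h t : ℝ) (a : A) :
    α.aut t (α.orbitIntegral h a) = ∫ s in t..t + h, α.aut s a := by
  rw [← α.autCLM_apply, orbitIntegral, ← ContinuousLinearMap.intervalIntegral_comp_comm]
  · simp only [autCLM_apply, ← α.aut_add]
    simpa using intervalIntegral.integral_comp_add_left (a := 0) (b := h) (fun s => α.aut s a) t
  · exact (α.continuous_aut a).intervalIntegrable _ _

/-- Moving the integral along the flow only shifts its window to `[t, t + h]`, so the derivative is
the difference of the endpoint values. -/
theorem hasDerivAt_aut_orbitIntegral (α : CStarDynamics A) (h : ℝ) (a : A) :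
    HasDerivAt (fun t => α.aut t (α.orbitIntegral h a)) (α.aut h a - a) 0 := by
  have hc := α.continuous_aut a
  have h₁ : HasDerivAt (fun t => ∫ s in (0 : ℝ)..t, α.aut s a) (α.aut 0 a) 0 :=
    (hc.integral_hasStrictDerivAt 0 0).hasDerivAt
  have h₂ : HasDerivAt (fun t => ∫ s in (0 : ℝ)..t, α.aut s a) (α.aut h a) (0 + h) := by
    simpa using (hc.integral_hasStrictDerivAt 0 h).hasDerivAt
  have h₃ := (h₂.comp_add_const 0 h).sub h₁
  rw [α.aut_zero] at h₃
  refine h₃.congr_of_eventuallyEq (Eventually.of_forall fun t => ?_)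
  simp only [aut_orbitIntegral, Pi.sub_apply]
  exact (intervalIntegral.integral_interval_sub_left (hc.intervalIntegrable _ _)
    (hc.intervalIntegrable _ _)).symm

theorem hasDerivAt_aut (α : CStarDynamics A) {a b : A}
    (hab : HasDerivAt (fun t => α.aut t a) b 0) (t : ℝ) :
    HasDerivAt (fun s => α.aut s a) (α.aut t b) t := by
  have h₁ : HasDerivAt (fun s => α.aut s a) b (t - t) := by simpa using hab
  have h₂ := ((α.autCLM t).restrictScalars ℝ).hasFDerivAt.comp_hasDerivAt t
    (h₁.comp_sub_const t t)
  refine h₂.congr_of_eventuallyEq (Eventually.of_forall fun s => ?_)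
  change α.aut s a = α.aut t (α.aut (s - t) a)
  rw [← α.aut_add, add_sub_cancel]

/-- Since `α_s` and `α_t` commute, `D(δ)` is invariant and `δ` commutes with `α_t`; the hypothesis
on `δ` can thus be applied along a whole orbit. -/
theorem hasDerivAt_aut_aut (α : CStarDynamics A) {a b : A}
    (hab : HasDerivAt (fun t => α.aut t a) b 0) (t : ℝ) :
    HasDerivAt (fun s => α.aut s (α.aut t a)) (α.aut t b) 0 := by
  refine (((α.autCLM t).restrictScalars ℝ).hasFDerivAt.comp_hasDerivAt 0
    hab).congr_of_eventuallyEq (Eventually.of_forall fun s => ?_)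
  change α.aut s (α.aut t a) = α.aut t (α.aut s a)
  rw [← α.aut_add, ← α.aut_add, add_comm]

theorem tendsto_inv_smul_integral {E : Type*} [NormedAddCommGroup E] [NormedSpace ℝ E]
    [CompleteSpace E] {f : ℝ → E} (hf : Continuous f) :
    Tendsto (fun h : ℝ => h⁻¹ • ∫ s in (0 : ℝ)..h, f s) (𝓝[≠] 0) (𝓝 (f 0)) := by
  simpa [hasDerivAt_iff_tendsto_slope_zero] using
    (hf.integral_hasStrictDerivAt 0 0).hasDerivAt

/-- The domain of the generator is dense. -/
theorem dense_generator_domain (α : CStarDynamics A) :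
    Dense {a : A | ∃ b, HasDerivAt (fun t => α.aut t a) b 0} := by
  intro a
  have h := tendsto_inv_smul_integral (α.continuous_aut a)
  rw [α.aut_zero] at h
  -- The approximants of `a` are the averages of its orbit over `[0, h]`.
  refine mem_closure_of_tendsto h (Eventually.of_forall fun h => ?_)
  refine ⟨h⁻¹ • (α.aut h a - a),
    ((α.hasDerivAt_aut_orbitIntegral h a).const_smul h⁻¹).congr_of_eventuallyEq
      (Eventually.of_forall fun t => ?_)⟩
  exact ((α.autCLM t).restrictScalars ℝ).map_smul h⁻¹ (α.orbitIntegral h a)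

/-- Positivity of `-i ω(a* δ a)` on the domain of `δ`, in terms of derivatives. -/
theorem generator_condition_iff [PartialOrder A] (α : CStarDynamics A) (ω : A →ₚ[ℂ] ℂ) :
    (∀ a : α.generator.domain, 0 ≤ -Complex.I * ω (star (a : A) * α.generator a)) ↔
      ∀ a b : A, HasDerivAt (fun t => α.aut t a) b 0 → 0 ≤ -Complex.I * ω (star a * b) := by
  constructor
  · intro H a b hab
    have h := H ⟨a, hab.differentiableAt⟩
    rwa [show α.generator ⟨a, hab.differentiableAt⟩ = b from hab.deriv] at h
  · intro H a
    exact H a _ (DifferentiableAt.hasDerivAt (𝕜 := ℝ) a.2)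

end Dynamics

/-! ### Transfer to the GNS space, invariance and positivity -/

section GNS

variable {A : Type*} [NonUnitalCStarAlgebra A] [PartialOrder A] [StarOrderedRing A]

/-- The class of an element of the algebra in the GNS Hilbert space. -/
noncomputable def gnsClass (ω : A →ₚ[ℂ] ℂ) : A →L[ℂ] ω.GNS where
  toFun a := (ω.toPreGNS a : ω.PreGNS)
  map_add' a b := by rw [map_add, UniformSpace.Completion.coe_add]
  map_smul' c a := by simp
  cont := continuous_toGNS ω

theorem inner_gnsClass (ω : A →ₚ[ℂ] ℂ) (a b : A) :
    ⟪gnsClass ω a, gnsClass ω b⟫_ℂ = ω (star a * b) := by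
  simp [gnsClass, PositiveLinearMap.preGNS_inner_def]

theorem denseRange_gnsClass (ω : A →ₚ[ℂ] ℂ) : DenseRange (gnsClass ω) :=
  UniformSpace.Completion.denseRange_coe.comp ω.toPreGNS.surjective.denseRange
    (UniformSpace.Completion.continuous_coe _)

theorem gnsMap_gnsClass (α : CStarDynamics A) (ω : A →ₚ[ℂ] ℂ) (h : α.Invariant ω) (t : ℝ)
    (a : A) : α.gnsMap ω h t (gnsClass ω a) = gnsClass ω (α.aut t a) :=
  α.gnsMap_coe ω h t a

/-- Positivity of the Hamiltonian in the GNS space, in terms of derivatives. -/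
theorem hamiltonian_isPositiveOp_iff (α : CStarDynamics A) (ω : A →ₚ[ℂ] ℂ)
    (h : α.Invariant ω) :
    (α.gnsUnitaryGroup ω h).hamiltonian.IsPositiveOp ↔
      ∀ ψ φ : ω.GNS, HasDerivAt (fun t => α.gnsMap ω h t ψ) φ 0 →
        0 ≤ -Complex.I * ⟪ψ, φ⟫_ℂ := by
  constructor
  · intro H ψ φ hd
    have hp := H ⟨ψ, hd.differentiableAt⟩
    rwa [show (α.gnsUnitaryGroup ω h).hamiltonian ⟨ψ, hd.differentiableAt⟩ =
      (-Complex.I) • φ from congrArg ((-Complex.I) • ·) hd.deriv, inner_smul_right] at hp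
  · intro H ψ
    have hp := H ψ _ (DifferentiableAt.hasDerivAt (𝕜 := ℝ) ψ.2)
    rw [← inner_smul_right] at hp
    exact hp

theorem generator_condition_of_isGroundState (α : CStarDynamics A) (ω : A →ₚ[ℂ] ℂ)
    (H : α.IsGroundState ω) {a b : A} (hab : HasDerivAt (fun t => α.aut t a) b 0) :
    0 ≤ -Complex.I * ω (star a * b) := by
  obtain ⟨-, h, hp⟩ := H
  rw [← inner_gnsClass]
  refine (α.hamiltonian_isPositiveOp_iff ω h).1 hp _ _ ?_
  simp only [gnsMap_gnsClass]
  exact ((gnsClass ω).restrictScalars ℝ).hasFDerivAt.comp_hasDerivAt 0 hab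

/-- Under the generator condition, `ω` is constant along the orbit of `a* a` for `a` in the domain
of the generator. -/
theorem apply_aut_star_mul_self (α : CStarDynamics A) (ω : A →ₚ[ℂ] ℂ)
    (H : ∀ a b : A, HasDerivAt (fun t => α.aut t a) b 0 → 0 ≤ -Complex.I * ω (star a * b))
    {a b : A} (hab : HasDerivAt (fun t => α.aut t a) b 0) (t : ℝ) :
    ω (α.aut t (star a * a)) = ω (star a * a) := by
  have hd : ∀ s, HasDerivAt (fun t => ω (α.aut t (star a * a))) 0 s := by
    intro s
    have h₁ : HasDerivAt (fun t => gnsClass ω (α.aut t a)) (gnsClass ω (α.aut s b)) s :=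
      ((gnsClass ω).restrictScalars ℝ).hasFDerivAt.comp_hasDerivAt s (α.hasDerivAt_aut hab s)
    have h₂ := h₁.inner ℂ h₁
    have h₃ := H _ _ (α.hasDerivAt_aut_aut hab s)
    rw [← inner_gnsClass] at h₃
    -- The hypothesis makes `-i` times the first term real, so that term is purely imaginary and
    -- cancels its conjugate.
    have h₄ : ⟪gnsClass ω (α.aut s a), gnsClass ω (α.aut s b)⟫_ℂ +
        ⟪gnsClass ω (α.aut s b), gnsClass ω (α.aut s a)⟫_ℂ = 0 := by
      rw [← inner_conj_symm (gnsClass ω (α.aut s b))]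
      have hre := (Complex.nonneg_iff.1 h₃).2
      generalize ⟪gnsClass ω (α.aut s a), gnsClass ω (α.aut s b)⟫_ℂ = z at hre
      have hz : z.re = 0 := by simpa using hre.symm
      rw [Complex.add_conj, hz, mul_zero, Complex.ofReal_zero]
    rw [h₄] at h₂
    simpa only [inner_gnsClass, map_mul, map_star] using h₂
  have := is_const_of_deriv_eq_zero (fun s => (hd s).differentiableAt) (fun s => (hd s).deriv) t 0
  simpa only [α.aut_zero] using this

theorem invariant_of_generator_condition (α : CStarDynamics A) (ω : A →ₚ[ℂ] ℂ)
    (H : ∀ a b : A, HasDerivAt (fun t => α.aut t a) b 0 → 0 ≤ -Complex.I * ω (star a * b)) :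
    α.Invariant ω := by
  intro t
  have hω : Continuous ω := map_continuous ω
  have hα : Continuous (α.aut t) := (α.autCLM t).continuous
  have hsq : ∀ a : A, ω (α.aut t (star a * a)) = ω (star a * a) := by
    intro a
    have hs : Continuous fun a : A => star a * a := by fun_prop
    refine α.dense_generator_domain.induction
      (P := fun a => ω (α.aut t (star a * a)) = ω (star a * a)) ?_
      (isClosed_eq (hω.comp (hα.comp hs)) (hω.comp hs)) a
    rintro a ⟨b, hab⟩
    exact α.apply_aut_star_mul_self ω H hab t
  intro a
  -- Every element is a combination of positive ones, and these have the form `b* b`.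
  have ha : a ∈ Submodule.span ℂ {a : A | 0 ≤ a} := by simp [CStarAlgebra.span_nonneg]
  have hlin : Set.EqOn (ω.toLinearMap ∘ₗ α.lin t) ω.toLinearMap {a : A | 0 ≤ a} := by
    intro a ha
    obtain ⟨b, rfl⟩ := CStarAlgebra.nonneg_iff_eq_star_mul_self.1 ha
    exact hsq b
  exact LinearMap.eqOn_span hlin ha

theorem continuous_integral_gnsMap (α : CStarDynamics A) (ω : A →ₚ[ℂ] ℂ) (h : α.Invariant ω)
    (r : ℝ) : Continuous fun ψ => ∫ s in (0 : ℝ)..r, α.gnsMap ω h s ψ := by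
  refine (LipschitzWith.of_dist_le_mul (K := ‖r‖₊) fun ψ φ => ?_).continuous
  rw [dist_eq_norm, dist_eq_norm, ← intervalIntegral.integral_sub
    ((α.continuous_gnsMap ω h ψ).intervalIntegrable _ _)
    ((α.continuous_gnsMap ω h φ).intervalIntegrable _ _)]
  refine (intervalIntegral.norm_integral_le_of_norm_le_const (C := ‖ψ - φ‖) fun s _ => ?_).trans_eq
    (by simp [mul_comm])
  rw [← map_sub, norm_gnsMap]

/-- On a class `[a]` this is the generator condition for the orbit integral of `a`. Both entries
depend continuously on `ψ`, so density of the classes suffices. -/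
theorem inner_integral_gnsMap_nonneg (α : CStarDynamics A) (ω : A →ₚ[ℂ] ℂ) (h : α.Invariant ω)
    (H : ∀ a b : A, HasDerivAt (fun t => α.aut t a) b 0 → 0 ≤ -Complex.I * ω (star a * b))
    (r : ℝ) (ψ : ω.GNS) :
    0 ≤ -Complex.I * ⟪∫ s in (0 : ℝ)..r, α.gnsMap ω h s ψ, α.gnsMap ω h r ψ - ψ⟫_ℂ := by
  refine (denseRange_gnsClass ω).induction_on
    (p := fun ψ => 0 ≤ -Complex.I *
      ⟪∫ s in (0 : ℝ)..r, α.gnsMap ω h s ψ, α.gnsMap ω h r ψ - ψ⟫_ℂ) ψ ?_ fun a => ?_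
  · refine isClosed_Ici.preimage (f := fun ψ => -Complex.I *
      ⟪∫ s in (0 : ℝ)..r, α.gnsMap ω h s ψ, α.gnsMap ω h r ψ - ψ⟫_ℂ) ?_
    have := α.continuous_integral_gnsMap ω h r
    fun_prop
  · have hi : ∫ s in (0 : ℝ)..r, α.gnsMap ω h s (gnsClass ω a) =
        gnsClass ω (α.orbitIntegral r a) := by
      simp only [gnsMap_gnsClass]
      exact (gnsClass ω).intervalIntegral_comp_comm
        ((α.continuous_aut a).intervalIntegrable _ _)
    rw [hi, gnsMap_gnsClass, ← map_sub, inner_gnsClass]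
    exact H _ _ (α.hasDerivAt_aut_orbitIntegral r a)

theorem hamiltonian_isPositiveOp (α : CStarDynamics A) (ω : A →ₚ[ℂ] ℂ) (h : α.Invariant ω)
    (H : ∀ a b : A, HasDerivAt (fun t => α.aut t a) b 0 → 0 ≤ -Complex.I * ω (star a * b)) :
    (α.gnsUnitaryGroup ω h).hamiltonian.IsPositiveOp := by
  refine (α.hamiltonian_isPositiveOp_iff ω h).2 fun ψ φ hd => ?_
  have h₁ := tendsto_inv_smul_integral (α.continuous_gnsMap ω h ψ)
  have h₂ := hasDerivAt_iff_tendsto_slope_zero.1 hd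
  simp only [gnsMap_zero, zero_add] at h₁ h₂
  refine ge_of_tendsto' ((h₁.inner h₂).const_mul (-Complex.I)) fun r => ?_
  -- One factor `r⁻¹` comes from each entry of the inner product, so the sign of `r` does not
  -- matter; at `r = 0` the convention `0⁻¹ = 0` is harmless.
  have hr : (0 : ℂ) ≤ ((r⁻¹ * r⁻¹ : ℝ) : ℂ) := by
    exact_mod_cast mul_self_nonneg r⁻¹
  have := mul_nonneg hr (α.inner_integral_gnsMap_nonneg ω h H r ψ)
  convert this using 1
  rw [← Complex.coe_smul, ← Complex.coe_smul, inner_smul_left, inner_smul_right]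
  push_cast
  simp only [map_inv₀, Complex.conj_ofReal]
  ring

end GNS

end CStarDynamics

theorem mainTheorem8 {A : Type*} [NonUnitalCStarAlgebra A] [PartialOrder A] [StarOrderedRing A]
    (α : CStarDynamics A) (ω : A →ₚ[ℂ] ℂ) (hω : ω.IsState) :
    α.IsGroundState ω ↔
      ∀ a : α.generator.domain, 0 ≤ -Complex.I * ω (star (a : A) * α.generator a) := by
  rw [α.generator_condition_iff ω]
  refine ⟨fun H a b hab => α.generator_condition_of_isGroundState ω H hab, fun H => ⟨hω, ?_⟩⟩
  have h := α.invariant_of_generator_condition ω H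
  exact ⟨h, α.hamiltonian_isPositiveOp ω h H⟩
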